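/- Throughout, $\log$ is the logarithm to base $2$. For a family $\mathcal F\subseteq 2^{[n]}$ let $\mathrm{supp}(\mathcal F)=\bigcup_{S\in\mathcal F}S$ and, for $J\subseteq[n]$, $\mathcal F_J=\{S\cap J: S\in\mathcal F\}$. Sets $S_1,\dots,S_k\subseteq[n]$ form a $k$-moonflower if there is $I\subseteq[n]$ such that the sets $S_i\setminus I$ are nonempty and pairwise disjoint; $\mathcal F$ is $k$-moonflower-free if it contains no $k$-moonflower. A $w$-set is a set of size at most $w$. A family $\mathcal G\subseteq 2^{[n]}$ is $p$-covered if there is a probability distribution $Q$ on $[n]$ with $\sum_{i\in S}Q(i)\ge p$ for every $S\in\mathcal G$; and $\mathcal F$ is $(p,M)$-almost-covered if for every $J\subseteq[n]$ there is $\mathcal S_J\subseteq\mathcal F_J$ with $|\mathcal S_J|\le M$ such that $\mathcal F_J\setminus\mathcal S_J$ is $p$-covered. **Lemma.** There is an absolute constant $B\ge 1$ such that the following holds. Let $1\le k\le n$, $w\ge 0$ be integers, let $p\in(0,1)$, and let $\mathcal F\subseteq 2^{[n]}$ be a $k$-moonflower-free family of $w$-sets with $|\mathrm{supp}(\mathcal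 F)|=n$. 1. If $n\ge 2k$ and $p\le 1/2$, then $\mathcal F$ is $(p,2^{h})$-almost-covered with $$h=B\cdot k\log\Big(\frac nk\Big)\cdot p\log(1/p).$$ 2. In all cases, $\mathcal F$ is $(p,2^{h'})$-almost-covered with $$h'=B\cdot k\log\Big(\frac{en}{k}\Big)\cdot p\log(2/p).$$ -/

import Mathlib

namespace Moonflower

variable {α : Type*} [DecidableEq α]

/-- The support of a family of sets: the union of its members. -/
def supp (F : Finset (Finset α)) : Finset α := F.biUnion id

/-- `S 0, …, S (k-1)` is a `k`-moonflower: for some set `I` the sets `S i \ I` are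
nonempty and pairwise disjoint. -/
def IsMoonflower {k : ℕ} (S : Fin k → Finset α) : Prop :=
  ∃ I : Finset α, (∀ i, (S i \ I).Nonempty) ∧ ∀ i j, i ≠ j → Disjoint (S i \ I) (S j \ I)

/-- `F` contains no `k`-moonflower. (The members of a moonflower are automatically distinct.) -/
def MoonflowerFree (k : ℕ) (F : Finset (Finset α)) : Prop :=
  ∀ S : Fin k → Finset α, (∀ i, S i ∈ F) → ¬ IsMoonflower S

/-- The projection (trace) `F_J = {S ∩ J : S ∈ F}`. -/
def proj (F : Finset (Finset α)) (J : Finset α) : Finset (Finset α) :=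
  F.image fun S => S ∩ J

/-- `G` is `p`-covered: some probability distribution `Q` on the ground set gives every
member of `G` mass at least `p`. -/
def PCovered [Fintype α] (p : ℝ) (G : Finset (Finset α)) : Prop :=
  ∃ Q ∈ stdSimplex ℝ α, ∀ S ∈ G, p ≤ ∑ i ∈ S, Q i

/-- `F` is `(p, M)`-almost-covered: each projection is `p`-covered after the removal of at
most `M` of its sets. -/
def AlmostCovered [Fintype α] (p M : ℝ) (F : Finset (Finset α)) : Prop :=
  ∀ J : Finset α, ∃ E ⊆ proj F J, (E.card : ℝ) ≤ M ∧ PCovered p (proj F J \ E)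

end Moonflower

namespace Moonflower

variable {α : Type*} [DecidableEq α]

/-! A star in a projection of a moonflower-free family has fewer than k tips, since its petals lift
to a moonflower. By minimax this becomes a measure statement: some Q satisfies |T| ≤ 4k·Q(U) for
every star of F_J with tips T inside U (`exists_simplex_forall_hasStar`). If no such Q existed, some
mixture of stars would rarely cover any given point, and independent draws from it would merge into
a star with at least k tips.

Let E be the family of light sets, Q(S) < p; these are the exceptional sets. If Q(supp E) ≤ 4p,
every star of E has at most 16kp tips, so the VC dimension of E is at most 16kp and Sauer–Shelah
bounds |E|. Otherwise `exists_subset_half_supp` finds a subfamily smaller by a factor of at most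
exp(O(kp)) whose support has at most half the mass. About log(1/p) halvings reach the first case, so
log |E| = O(kp(log(1/p) + log(n/k) + 1)), which is at most the product form claimed. -/

/-! ### Stars and moonflowers -/

/-- `G` has a star with tips `T` inside `U`: every `x ∈ T` is the only point of `T` in some
member of `G` contained in `U`. -/
def HasStar (G : Finset (Finset α)) (T U : Finset α) : Prop :=
  ∀ x ∈ T, ∃ R ∈ G, R ⊆ U ∧ R ∩ T = {x}

theorem HasStar.mono_left {G G' : Finset (Finset α)} {T U : Finset α} (h : HasStar G T U)
    (hG : G ⊆ G') : HasStar G' T U := fun x hx =>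
  let ⟨R, hR, h'⟩ := h x hx
  ⟨R, hG hR, h'⟩

theorem HasStar.subset {G : Finset (Finset α)} {T U : Finset α} (h : HasStar G T U) : T ⊆ U := by
  intro x hx
  obtain ⟨R, -, hRU, hRT⟩ := h x hx
  have : x ∈ R ∩ T := by simp [hRT]
  exact hRU (Finset.mem_inter.1 this).1

theorem subset_supp {F : Finset (Finset α)} {S : Finset α} (hS : S ∈ F) : S ⊆ supp F :=
  Finset.subset_biUnion_of_mem id hS

/-- A star in a projection of a `k`-moonflower-free family has fewer than `k` tips. -/
theorem MoonflowerFree.card_lt_of_hasStar {k : ℕ} {F : Finset (Finset α)}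
    (hF : MoonflowerFree k F) {J T U : Finset α} (h : HasStar (proj F J) T U) : T.card < k := by
  by_contra! hk
  obtain ⟨T', hT', hcard⟩ := Finset.exists_subset_card_eq hk
  -- Every tip lies in J, so lifting a petal from F_J to F adds no further tips.
  have h1 : ∀ x ∈ T, ∃ S ∈ F, x ∈ S ∧ ∀ y ∈ T, y ∈ S → y = x := by
    intro x hx
    obtain ⟨R, hR, -, hRT⟩ := h x hx
    obtain ⟨S, hS, rfl⟩ := Finset.mem_image.1 hR
    have hxR : x ∈ S ∩ J ∩ T := by simp [hRT]
    refine ⟨S, hS, (Finset.mem_inter.1 (Finset.mem_inter.1 hxR).1).1, fun y hy hyS => ?_⟩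
    obtain ⟨R', hR', -, hRT'⟩ := h y hy
    obtain ⟨S', hS', rfl⟩ := Finset.mem_image.1 hR'
    have hyJ : y ∈ S' ∩ J ∩ T := by simp [hRT']
    simp only [Finset.mem_inter] at hyJ
    have : y ∈ S ∩ J ∩ T := by simp [hyS, hyJ.1.2, hy]
    simpa [hRT] using this
  choose! S hSF hxS hS using h1
  let e : Fin k ≃ T' := (T'.equivFinOfCardEq hcard).symm
  have he : ∀ i, (e i : α) ∈ T := fun i => hT' (e i).2
  -- Removing I = supp F \ T leaves exactly the tip of each petal; `supp F` stands in for the whole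
  -- ground set, which may be infinite here.
  refine hF (fun i => S (e i)) (fun i => hSF _ (he i)) ⟨(supp F) \ T, fun i => ⟨e i, ?_⟩, ?_⟩
  · simp [he i, hxS _ (he i)]
  · intro i j hij
    rw [Finset.disjoint_left]
    intro y hy hy'
    simp only [Finset.mem_sdiff, not_and, not_not] at hy hy'
    have hyT : y ∈ T := hy.2 (subset_supp (hSF _ (he i)) hy.1)
    have := (hS _ (he i) y hyT hy.1).symm.trans (hS _ (he j) y hyT hy'.1)
    exact hij (e.injective (Subtype.ext this))

/-! ### Minimax -/

/-- A finite minimax theorem: either some `Q` in the simplex gives every `v i` value at least `c`,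
or some convex combination of the `v i` is everywhere below `c`. -/
theorem exists_simplex_le_or_exists_combination_lt {ι α : Type*} [Fintype ι] [Fintype α]
    [Nonempty α] (v : ι → α → ℝ) (c : ℝ) :
    (∃ Q ∈ stdSimplex ℝ α, ∀ i, c ≤ ∑ y, Q y * v i y) ∨
      ∃ l ∈ stdSimplex ℝ ι, ∀ y, ∑ i, l i * v i y < c := by
  classical
  rcases isEmpty_or_nonempty ι with hι | ⟨⟨i₀⟩⟩
  · left
    obtain ⟨y⟩ := ‹Nonempty α›
    exact ⟨_, single_mem_stdSimplex ℝ y, fun i => (hι.false i).elim⟩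
  by_contra! hcon
  obtain ⟨hQ, hl⟩ := hcon
  let φ : (ι → ℝ) →ₗ[ℝ] (α → ℝ) := ∑ i, (LinearMap.proj i).smulRight (v i)
  have hφ : ∀ l y, φ l y = ∑ i, l i * v i y := by
    intro l y
    simp [φ, LinearMap.sum_apply, Finset.sum_apply]
  have hO : Convex ℝ {a : α → ℝ | ∀ y, a y < c} := by
    have : {a : α → ℝ | ∀ y, a y < c} = Set.pi Set.univ (fun _ => Set.Iio c) := by
      ext; simp
    rw [this]
    exact convex_pi fun _ _ => convex_Iio c
  have hO' : IsOpen {a : α → ℝ | ∀ y, a y < c} := by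
    have : {a : α → ℝ | ∀ y, a y < c} = Set.pi Set.univ (fun _ => Set.Iio c) := by
      ext; simp
    rw [this]
    exact isOpen_set_pi Set.finite_univ fun _ _ => isOpen_Iio
  have hK : Convex ℝ (φ '' stdSimplex ℝ ι) := (convex_stdSimplex ℝ ι).linear_image φ
  -- Separate the open orthant below c from the set of all mixtures; the coefficients of f,
  -- normalized, form the sought Q.
  obtain ⟨f, u, hfO, hfK⟩ := geometric_hahn_banach_open hO hO' hK (by
    rw [Set.disjoint_left]
    rintro _ ha ⟨l, hl', rfl⟩
    obtain ⟨y, hy⟩ := hl l hl'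
    have := ha y
    rw [hφ] at this
    exact absurd this (not_lt.2 hy))
  let q : α → ℝ := fun y => f (Pi.single y 1)
  have hf : ∀ a, f a = ∑ y, q y * a y := by
    intro a
    have := (f : (α → ℝ) →ₗ[ℝ] ℝ).pi_apply_eq_sum_univ a
    simp only [ContinuousLinearMap.coe_coe, smul_eq_mul] at this
    rw [this]
    refine Finset.sum_congr rfl fun y _ => ?_
    rw [mul_comm]
    congr 2
    ext z
    simp [Pi.single_apply, eq_comm]
  have hv : ∀ i, u ≤ ∑ y, q y * v i y := by
    intro i
    rw [← hf]
    have := hfK (φ (Pi.single i 1)) ⟨_, single_mem_stdSimplex ℝ i, rfl⟩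
    convert this
    ext y
    rw [hφ]
    simp [Pi.single_apply]
  have hconst : ∀ ε : ℝ, 0 < ε → (c - ε) * ∑ y, q y < u := by
    intro ε hε
    have := hfO (fun _ => c - ε) (fun y => by simpa using hε)
    rwa [hf, ← Finset.sum_mul, mul_comm] at this
  -- The orthant is unbounded below, so a negative coefficient would make f unbounded above on it.
  have hq : ∀ y, 0 ≤ q y := by
    intro y
    by_contra! hy
    obtain ⟨t, ht⟩ := exists_nat_gt ((u - (c - 1) * ∑ y, q y) / (- q y))
    have h0 := hfO (fun z => (c - 1) - t * Pi.single (M := fun _ => ℝ) y 1 z) (fun z => by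
      have : (0 : ℝ) ≤ t * Pi.single (M := fun _ => ℝ) y 1 z := by
        refine mul_nonneg t.cast_nonneg ?_
        by_cases h : z = y <;> simp [h]
      linarith)
    rw [hf] at h0
    simp only [mul_sub, Finset.sum_sub_distrib, ← Finset.sum_mul] at h0
    have h2 : ∑ z, q z * (t * Pi.single (M := fun _ => ℝ) y 1 z) = q y * t := by
      simp [Pi.single_apply]
    rw [div_lt_iff₀ (by linarith)] at ht
    have h3 : (∑ z, q z) * c - (∑ z, q z) * 1 - ∑ z, q z * (t * Pi.single (M := fun _ => ℝ) y 1 z) < u := by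
      simpa [mul_sub, Finset.sum_mul] using h0
    rw [h2] at h3
    linarith
  have hs : 0 < ∑ y, q y := by
    rcases (Finset.sum_nonneg fun y _ => hq y : 0 ≤ ∑ y, q y).lt_or_eq with h | h
    · exact h
    · exfalso
      have hz : ∀ y, q y = 0 := fun y =>
        (Finset.sum_eq_zero_iff_of_nonneg fun y _ => hq y).1 h.symm y (Finset.mem_univ y)
      have h1 := hconst 1 one_pos
      have h2 := hv i₀
      simp [hz] at h1 h2
      linarith
  have hcu : c * ∑ y, q y ≤ u := by
    by_contra! h
    have := hconst ((c * ∑ y, q y - u) / ∑ y, q y) (div_pos (by linarith) hs)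
    rw [sub_mul, div_mul_cancel₀ _ hs.ne'] at this
    linarith
  obtain ⟨i, hi⟩ := hQ (fun y => q y / ∑ y, q y)
    ⟨fun y => div_nonneg (hq y) hs.le, by rw [← Finset.sum_div, div_self hs.ne']⟩
  have h1 : ∑ y, q y / (∑ y, q y) * v i y = (∑ y, q y * v i y) / ∑ y, q y := by
    rw [Finset.sum_div]
    exact Finset.sum_congr rfl fun y _ => by ring
  rw [h1, div_lt_iff₀ hs] at hi
  linarith [hv i]

/-! ### Merging random stars, and the measure Q -/

theorem exists_le_of_le_weighted_sum {ι : Type*} (s : Finset ι) {w g : ι → ℝ} {a : ℝ}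
    (hw : ∀ i ∈ s, 0 ≤ w i) (hs : ∑ i ∈ s, w i = 1) (ha : a ≤ ∑ i ∈ s, w i * g i) :
    ∃ i ∈ s, a ≤ g i := by
  by_contra! h
  obtain ⟨i, hi, hi0⟩ : ∃ i ∈ s, 0 < w i := by
    by_contra! h0
    linarith [Finset.sum_nonpos h0]
  have : ∑ i ∈ s, w i * g i < ∑ i ∈ s, w i * a :=
    Finset.sum_lt_sum (fun j hj => mul_le_mul_of_nonneg_left (h j hj).le (hw j hj))
      ⟨i, hi, mul_lt_mul_of_pos_left (h i hi) hi0⟩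
  rw [← Finset.sum_mul, hs, one_mul] at this
  linarith

theorem sum_pi_prod_eq_pow {ι : Type*} [Fintype ι] (m : ℕ) (a : ι → ℝ) :
    ∑ f : Fin m → ι, ∏ j, a (f j) = (∑ i, a i) ^ m := by
  classical
  have := Finset.prod_univ_sum (fun _ : Fin m => (Finset.univ : Finset ι)) (fun _ => a)
  simpa using this.symm

/-- Used for the probability that draw i has x as a tip while the other m - 1 draws miss x. -/
theorem sum_pi_prod_ite {ι : Type*} [Fintype ι] {m : ℕ} (i : Fin m) (a b : ι → ℝ) :
    ∑ f : Fin m → ι, ∏ j, (if j = i then a (f j) else b (f j)) =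
      (∑ s, a s) * (∑ s, b s) ^ (m - 1) := by
  classical
  have := Finset.prod_univ_sum (fun _ : Fin m => (Finset.univ : Finset ι))
    (fun j s => if j = i then a s else b s)
  rw [Fintype.piFinset_univ] at this
  rw [← this, ← Finset.mul_prod_erase _ _ (Finset.mem_univ i)]
  simp only [if_true]
  congr 1
  rw [Finset.prod_congr rfl (g := fun _ => ∑ s, b s)]
  · simp
  · intro j hj
    simp [Finset.ne_of_mem_erase hj]

/-- Merging `m` independent random stars: keep the tips that no other sampled star touches. -/
theorem exists_hasStar_of_sample [Fintype α] {ι : Type*} [Fintype ι] {G : Finset (Finset α)}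
    {T U : ι → Finset α} (hs : ∀ i, HasStar G (T i) (U i)) {ρ : ι → ℝ} (hρ : ρ ∈ stdSimplex ℝ ι)
    (m : ℕ) :
    ∃ T', HasStar G T' Finset.univ ∧
      m * ∑ x, (∑ i, if x ∈ T i then ρ i else 0) * (∑ i, if x ∈ U i then 0 else ρ i) ^ (m - 1)
        ≤ (T'.card : ℝ) := by
  classical
  let good : (Fin m → ι) → Fin m → Finset α := fun f i =>
    (T (f i)).filter fun x => ∀ j, j ≠ i → x ∉ U (f j)
  have hdisj : ∀ f, (Set.univ : Set (Fin m)).PairwiseDisjoint (good f) := by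
    intro f i _ j _ hij
    rw [Function.onFun, Finset.disjoint_left]
    intro x hx hx'
    simp only [good, Finset.mem_filter] at hx hx'
    exact hx.2 j hij.symm ((hs _).subset hx'.1)
  -- A petal of draw i stays inside U (f i), which the surviving tips of all other draws avoid.
  have hstar : ∀ f, HasStar G (Finset.univ.biUnion (good f)) Finset.univ := by
    intro f x hx
    obtain ⟨i, -, hi⟩ := Finset.mem_biUnion.1 hx
    have hxT := (Finset.mem_filter.1 hi).1
    obtain ⟨R, hR, hRU, hRT⟩ := hs _ x hxT
    refine ⟨R, hR, Finset.subset_univ _, ?_⟩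
    have hxR : x ∈ R := by
      have : x ∈ R ∩ T (f i) := by simp [hRT]
      exact (Finset.mem_inter.1 this).1
    ext y
    rw [Finset.mem_inter, Finset.mem_singleton]
    constructor
    · rintro ⟨hyR, hy⟩
      obtain ⟨j, -, hj⟩ := Finset.mem_biUnion.1 hy
      obtain ⟨hyT, hyU⟩ := Finset.mem_filter.1 hj
      by_cases hji : j = i
      · subst hji
        have : y ∈ R ∩ T (f j) := Finset.mem_inter.2 ⟨hyR, hyT⟩
        simpa [hRT] using this
      · exact absurd (hRU hyR) (hyU i (Ne.symm hji))
    · rintro rfl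
      exact ⟨hxR, hx⟩
  -- Survival of x as a tip of draw i is a product of one indicator per draw, so its expectation
  -- factors.
  have hcard : ∀ f, ((Finset.univ.biUnion (good f)).card : ℝ) =
      ∑ i, ∑ x, ∏ j, (if j = i then (if x ∈ T (f j) then (1 : ℝ) else 0)
        else if x ∈ U (f j) then 0 else 1) := by
    intro f
    rw [Finset.card_biUnion (fun i _ j _ hij => hdisj f trivial trivial hij)]
    push_cast
    refine Finset.sum_congr rfl fun i _ => ?_
    rw [show ((good f i).card : ℝ) = ∑ x, if x ∈ good f i then 1 else 0 by simp]
    refine Finset.sum_congr rfl fun x _ => ?_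
    simp only [good, Finset.mem_filter]
    split_ifs with hx
    · symm
      refine Finset.prod_eq_one fun j _ => ?_
      by_cases hj : j = i
      · subst hj
        simp [hx.1]
      · simp [hj, hx.2 j hj]
    · symm
      rw [not_and_or] at hx
      rcases hx with hx | hx
      · exact Finset.prod_eq_zero (Finset.mem_univ i) (by simp [hx])
      · push Not at hx
        obtain ⟨j, hj, hjU⟩ := hx
        exact Finset.prod_eq_zero (Finset.mem_univ j) (by simp [hj, hjU])
  obtain ⟨f, -, hf⟩ := exists_le_of_le_weighted_sum (Finset.univ : Finset (Fin m → ι))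
    (w := fun f => ∏ j, ρ (f j)) (g := fun f => ((Finset.univ.biUnion (good f)).card : ℝ))
    (a := m * ∑ x, (∑ i, if x ∈ T i then ρ i else 0) *
      (∑ i, if x ∈ U i then 0 else ρ i) ^ (m - 1))
    (fun f _ => Finset.prod_nonneg fun j _ => hρ.1 _)
    (by rw [sum_pi_prod_eq_pow, hρ.2, one_pow]) (le_of_eq (by
      simp only [hcard, Finset.mul_sum]
      rw [Finset.sum_comm]
      have : ∀ i : Fin m, ∑ f : Fin m → ι, ∑ x, (∏ j, ρ (f j)) *
          ∏ j, (if j = i then (if x ∈ T (f j) then (1 : ℝ) else 0)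
            else if x ∈ U (f j) then 0 else 1) =
          ∑ x, (∑ i, if x ∈ T i then ρ i else 0) *
            (∑ i, if x ∈ U i then 0 else ρ i) ^ (m - 1) := by
        intro i
        rw [Finset.sum_comm]
        refine Finset.sum_congr rfl fun x _ => ?_
        rw [← sum_pi_prod_ite i]
        refine Finset.sum_congr rfl fun f _ => ?_
        rw [← Finset.prod_mul_distrib]
        refine Finset.prod_congr rfl fun j _ => ?_
        split_ifs <;> simp
      rw [Finset.sum_congr rfl fun i _ => this i]
      simp [Finset.mul_sum]))
  exact ⟨_, hstar f, hf⟩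

/-- If all stars of `G` have fewer than `k` tips, then some probability distribution gives every
star mass proportional to its number of tips. -/
theorem exists_simplex_forall_hasStar [Fintype α] [Nonempty α] {k : ℕ} (hk : 0 < k)
    {G : Finset (Finset α)} (hG : ∀ T U, HasStar G T U → T.card < k) :
    ∃ Q ∈ stdSimplex ℝ α, ∀ T U, HasStar G T U → (T.card : ℝ) ≤ 4 * k * ∑ y ∈ U, Q y := by
  classical
  let ι := {s : Finset α × Finset α // HasStar G s.1 s.2 ∧ s.1.Nonempty}
  have hk' : (0 : ℝ) < k := by exact_mod_cast hk
  have hpos : ∀ s : ι, (0 : ℝ) < s.1.1.card := fun s => by exact_mod_cast s.2.2.card_pos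
  rcases exists_simplex_le_or_exists_combination_lt
    (fun (s : ι) y => if y ∈ s.1.2 then 1 / (s.1.1.card : ℝ) else 0) (1 / (4 * k)) with
    ⟨Q, hQ, h⟩ | ⟨l, hl, h⟩
  · refine ⟨Q, hQ, fun T U hTU => ?_⟩
    rcases T.eq_empty_or_nonempty with rfl | hT
    · rw [Finset.card_empty, Nat.cast_zero]
      exact mul_nonneg (by positivity) (Finset.sum_nonneg fun y _ => hQ.1 y)
    · have h1 := h ⟨(T, U), hTU, hT⟩
      have h2 : (0 : ℝ) < T.card := hpos ⟨(T, U), hTU, hT⟩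
      simp only [mul_ite, mul_zero, Finset.sum_ite_mem, Finset.univ_inter] at h1
      rw [← Finset.sum_mul, mul_one_div, div_le_div_iff₀ (by positivity) h2] at h1
      linarith
  · exfalso
    let Z := ∑ s : ι, l s / s.1.1.card
    have hterm : ∀ s : ι, l s / k ≤ l s / s.1.1.card := fun s =>
      div_le_div_of_nonneg_left (hl.1 s) (hpos s) (by exact_mod_cast (hG _ _ s.2.1).le)
    have hZk : 1 / k ≤ Z := by
      rw [← hl.2, Finset.sum_div]
      exact Finset.sum_le_sum fun s _ => hterm s
    have hZ : 0 < Z := lt_of_lt_of_le (by positivity) hZk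
    -- Weighting by 1/|T| turns the payoff bound into: each x lies in a random U with probability at
    -- most 1/(4kZ), while the expected number of tips is 1/Z.
    let ρ : ι → ℝ := fun s => l s / s.1.1.card / Z
    have hρ : ρ ∈ stdSimplex ℝ ι :=
      ⟨fun s => div_nonneg (div_nonneg (hl.1 s) (hpos s).le) hZ.le, by
        rw [← Finset.sum_div, div_self hZ.ne']⟩
    have hmass : ∑ x, ∑ s : ι, (if x ∈ s.1.1 then ρ s else 0) = 1 / Z := by
      rw [Finset.sum_comm, ← hl.2, Finset.sum_div]
      refine Finset.sum_congr rfl fun s _ => ?_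
      simp only [Finset.sum_ite_mem, Finset.univ_inter, Finset.sum_const, nsmul_eq_mul, ρ]
      have := (hpos s).ne'
      field_simp
    have hU : ∀ x, 1 - 1 / (4 * k * Z) ≤ ∑ s : ι, if x ∈ s.1.2 then 0 else ρ s := by
      intro x
      have h1 : ∑ s : ι, (if x ∈ s.1.2 then ρ s else 0) ≤ 1 / (4 * k * Z) := by
        have h2 := (h x).le
        have h3 : ∑ s : ι, (if x ∈ s.1.2 then ρ s else 0) =
            (∑ s : ι, l s * if x ∈ s.1.2 then 1 / (s.1.1.card : ℝ) else 0) / Z := by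
          rw [Finset.sum_div]
          refine Finset.sum_congr rfl fun s _ => ?_
          split_ifs <;> simp [ρ, div_eq_mul_inv]
        rw [h3, ← div_div]
        exact div_le_div_of_nonneg_right h2 hZ.le
      have h2 : ∑ s : ι, (if x ∈ s.1.2 then ρ s else 0) +
          ∑ s : ι, (if x ∈ s.1.2 then 0 else ρ s) = 1 := by
        rw [← Finset.sum_add_distrib, ← hρ.2]
        exact Finset.sum_congr rfl fun s _ => by split_ifs <;> simp
      linarith
    -- With m - 1 ≤ 2kZ, Bernoulli's inequality lets each tip survive with probability at least 1/2;
    -- with m ≥ 2kZ, at least k tips are expected.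
    let m := ⌈2 * k * Z⌉₊
    have hm : 2 * k * Z ≤ m := Nat.le_ceil _
    have hm1 : ((m - 1 : ℕ) : ℝ) ≤ 2 * k * Z := by
      have h1 : 0 < m := Nat.ceil_pos.2 (by positivity)
      have h2 : (m : ℝ) < 2 * k * Z + 1 := Nat.ceil_lt_add_one (by positivity)
      rw [Nat.cast_sub h1]
      push_cast
      linarith
    obtain ⟨T', hT', hcard⟩ := exists_hasStar_of_sample (T := fun s : ι => s.1.1)
      (U := fun s : ι => s.1.2) (fun s => s.2.1) hρ m
    have hkZ : 1 / (4 * k * Z) ≤ 1 := by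
      rw [div_le_iff₀ hk'] at hZk
      rw [div_le_one (by positivity)]
      nlinarith
    have hpow : ∀ x, 1 / 2 ≤ (∑ s : ι, if x ∈ s.1.2 then 0 else ρ s) ^ (m - 1) := by
      intro x
      have h1 : (1 - 1 / (4 * k * Z)) ^ (m - 1) ≤
          (∑ s : ι, if x ∈ s.1.2 then 0 else ρ s) ^ (m - 1) :=
        pow_le_pow_left₀ (by linarith) (hU x) _
      have h2 := one_add_mul_le_pow (a := -(1 / (4 * k * Z))) (by linarith) (m - 1)
      have h3 : ((m - 1 : ℕ) : ℝ) * (1 / (4 * k * Z)) ≤ 2 * k * Z * (1 / (4 * k * Z)) :=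
        mul_le_mul_of_nonneg_right hm1 (by positivity)
      have h4 : 2 * k * Z * (1 / (4 * k * Z)) = 1 / 2 := by field_simp; norm_num
      rw [← sub_eq_add_neg] at h2
      linarith
    have hfin : (k : ℝ) ≤ T'.card := by
      refine le_trans ?_ hcard
      have h1 : 1 / Z * (1 / 2) ≤ ∑ x, (∑ s : ι, if x ∈ s.1.1 then ρ s else 0) *
          (∑ s : ι, if x ∈ s.1.2 then 0 else ρ s) ^ (m - 1) := by
        rw [← hmass, Finset.sum_mul]
        refine Finset.sum_le_sum fun x _ => mul_le_mul_of_nonneg_left (hpow x) ?_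
        exact Finset.sum_nonneg fun s _ => by split_ifs; exacts [hρ.1 s, le_rfl]
      calc (k : ℝ) = 2 * k * Z * (1 / Z * (1 / 2)) := by field_simp
        _ ≤ _ := mul_le_mul hm h1 (by positivity) (by positivity)
    exact absurd (hG _ _ hT') (not_lt.2 (by exact_mod_cast hfin))

/-! ### Sauer–Shelah through stars -/

/-- Only the singleton traces of a shattered set are needed; hence star sizes bound the VC
dimension. -/
theorem shatters_hasStar {E : Finset (Finset α)} {T : Finset α} (h : E.Shatters T) :
    HasStar E T (supp E) := by
  intro x hx
  obtain ⟨R, hR, hRT⟩ := h (Finset.singleton_subset_iff.2 hx)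
  exact ⟨R, hR, subset_supp hR, by rw [Finset.inter_comm, hRT]⟩

/-- Multiplying by l^d ≤ l^i gives part of the binomial expansion of (1 + l)^n ≤ exp(ln). -/
theorem sum_choose_Iic_le (n d : ℕ) {l : ℝ} (hl : 0 < l) (hl1 : l ≤ 1) :
    ((∑ i ∈ Finset.Iic d, n.choose i : ℕ) : ℝ) ≤ Real.exp (d * Real.log (1 / l) + l * n) := by
  have h1 : ((∑ i ∈ Finset.Iic d, n.choose i : ℕ) : ℝ) * l ^ d ≤ (1 + l) ^ n := by
    push_cast
    rw [Finset.sum_mul, add_comm 1 l, add_pow]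
    calc ∑ i ∈ Finset.Iic d, (n.choose i : ℝ) * l ^ d
        ≤ ∑ i ∈ Finset.Iic d, (n.choose i : ℝ) * l ^ i :=
          Finset.sum_le_sum fun i hi => mul_le_mul_of_nonneg_left
            (pow_le_pow_of_le_one hl.le hl1 (Finset.mem_Iic.1 hi)) (Nat.cast_nonneg _)
      _ ≤ ∑ i ∈ Finset.Iic d ∪ Finset.range (n + 1), (n.choose i : ℝ) * l ^ i :=
          Finset.sum_le_sum_of_subset_of_nonneg Finset.subset_union_left
            fun i _ _ => by positivity
      _ = ∑ i ∈ Finset.range (n + 1), (n.choose i : ℝ) * l ^ i := by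
          symm
          refine Finset.sum_subset Finset.subset_union_right fun i _ hi => ?_
          rw [Nat.choose_eq_zero_of_lt (by simpa using hi)]
          simp
      _ = _ := Finset.sum_congr rfl fun i _ => by rw [one_pow]; ring
  have h2 : (1 + l) ^ n ≤ Real.exp (l * n) := by
    rw [mul_comm, Real.exp_nat_mul]
    exact pow_le_pow_left₀ (by positivity) (by linarith [Real.add_one_le_exp l]) _
  rw [Real.exp_add, Real.exp_nat_mul, Real.exp_log (by positivity), one_div, inv_pow,
    mul_comm, ← div_eq_mul_inv, le_div_iff₀ (by positivity)]
  exact h1.trans h2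

/-- Sauer–Shelah bound for a family without large stars. -/
theorem card_le_exp_of_hasStar_le [Fintype α] {E : Finset (Finset α)} {D l : ℝ}
    (hD : 0 ≤ D) (hE : ∀ T, HasStar E T (supp E) → (T.card : ℝ) ≤ D) (hl : 0 < l) (hl1 : l ≤ 1) :
    (E.card : ℝ) ≤ Real.exp (D * Real.log (1 / l) + l * Fintype.card α) := by
  have hd : (E.vcDim : ℝ) ≤ D := by
    have : E.vcDim ≤ ⌊D⌋₊ := Finset.sup_le fun T hT =>
      Nat.le_floor (hE T (shatters_hasStar (Finset.mem_shatterer.1 hT)))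
    exact (Nat.cast_le.2 this).trans (Nat.floor_le hD)
  have h1 : (E.card : ℝ) ≤ (∑ i ∈ Finset.Iic E.vcDim, (Fintype.card α).choose i : ℕ) := by
    exact_mod_cast (Finset.card_le_card_shatterer E).trans Finset.card_shatterer_le_sum_vcDim
  refine (h1.trans (sum_choose_Iic_le _ _ hl hl1)).trans (Real.exp_le_exp.2 ?_)
  have : 0 ≤ Real.log (1 / l) := Real.log_nonneg (by rw [le_div_iff₀ hl]; linarith)
  gcongr

/-! ### Stars from random points avoiding a hidden set -/

/-- If `x i` is, for each `i ∈ I`, the only listed point in some member of `E`, these points are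
the tips of a star. -/
theorem exists_hasStar_of_indices {E : Finset (Finset α)} {m : ℕ} (x : Fin m → α)
    (I : Finset (Fin m)) (hI : ∀ i ∈ I, ∃ R ∈ E, x i ∈ R ∧ ∀ j, j ≠ i → x j ∉ R) :
    ∃ T, HasStar E T (supp E) ∧ T.card = I.card := by
  refine ⟨I.image x, ?_, Finset.card_image_of_injOn ?_⟩
  · intro y hy
    obtain ⟨i, hi, rfl⟩ := Finset.mem_image.1 hy
    obtain ⟨R, hR, hiR, hRj⟩ := hI i hi
    refine ⟨R, hR, subset_supp hR, ?_⟩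
    ext z
    rw [Finset.mem_inter, Finset.mem_singleton]
    constructor
    · rintro ⟨hz, hz'⟩
      obtain ⟨j, -, rfl⟩ := Finset.mem_image.1 hz'
      by_contra hne
      exact hRj j (fun h => hne (by rw [h])) hz
    · rintro rfl
      exact ⟨hiR, hy⟩
  · intro i hi j _ hij
    obtain ⟨R, hR, hiR, hRj⟩ := hI i hi
    by_contra hne
    exact hRj j (Ne.symm hne) (hij ▸ hiR)

theorem card_filter_eq_sum_ite {m : ℕ} (P : Fin m → Prop) [DecidablePred P] :
    (((Finset.univ : Finset (Fin m)).filter P).card : ℝ) = ∑ i, if P i then (1 : ℝ) else 0 := by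
  simp

/-- The members of `E` that contain none of the listed points. -/
def avoiding (E : Finset (Finset α)) {r : ℕ} (t : Fin r → α) : Finset (Finset α) :=
  E.filter fun S => ∀ j, t j ∉ S

/-- The distribution `Q` conditioned on `W \ S`. -/
noncomputable def condWeight (Q : α → ℝ) (W S : Finset α) (y : α) : ℝ :=
  if y ∈ W \ S then Q y / ∑ z ∈ W \ S, Q z else 0

theorem condWeight_nonneg {Q : α → ℝ} (hQ : ∀ y, 0 ≤ Q y) (W S : Finset α) (y : α) :
    0 ≤ condWeight Q W S y := by
  unfold condWeight
  split_ifs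
  · exact div_nonneg (hQ y) (Finset.sum_nonneg fun z _ => hQ z)
  · exact le_rfl

theorem sum_condWeight [Fintype α] {Q : α → ℝ} {W S : Finset α}
    (h : 0 < ∑ z ∈ W \ S, Q z) : ∑ y, condWeight Q W S y = 1 := by
  simp only [condWeight, Finset.sum_ite_mem, Finset.univ_inter]
  rw [← Finset.sum_div, div_self h.ne']

/-- The sampled points leave few members of `E` with probability at most `1 / 2`. -/
theorem sum_sum_prod_condWeight_le [Fintype α] {E : Finset (Finset α)} {Q : α → ℝ}
    (hQ : ∀ y, 0 ≤ Q y) {p A : ℝ} {r : ℕ} (hA : 0 < A)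
    (hE : ∀ S ∈ E, ∑ y ∈ S, Q y ≤ p) (hw : p < ∑ y ∈ supp E, Q y)
    (hAr : 2 * ((∑ y ∈ supp E, Q y) / (∑ y ∈ supp E, Q y - p)) ^ r ≤ A) :
    ∑ S ∈ E, ∑ t : Fin r → α,
      (if A * (avoiding E t).card < E.card then ∏ j, condWeight Q (supp E) S (t j) else 0)
        ≤ E.card / 2 := by
  set w := ∑ y ∈ supp E, Q y with hwdef
  have hwp : 0 < w - p := by linarith
  let q : α → ℝ := fun y => if y ∈ supp E then Q y else 0
  have hq : ∀ y, 0 ≤ q y := fun y => by simp only [q]; split_ifs; exacts [hQ y, le_rfl]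
  have hqsum : ∑ y, q y = w := by simp [q, hwdef]
  -- As S is light, conditioning on its complement in supp E costs only the factor 1/(w - p),
  -- uniformly in S.
  have hle : ∀ S ∈ E, ∀ y, condWeight Q (supp E) S y ≤ q y / (w - p) := by
    intro S hS y
    have hD : w - p ≤ ∑ z ∈ supp E \ S, Q z := by
      have := Finset.sum_sdiff (f := Q) (subset_supp hS)
      linarith [hE S hS]
    unfold condWeight
    split_ifs with h
    · simp only [q, if_pos (Finset.mem_sdiff.1 h).1]
      exact div_le_div_of_nonneg_left (hQ y) hwp hD
    · exact div_nonneg (hq y) hwp.le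
  have hprod : ∀ S ∈ E, ∀ t : Fin r → α, ∏ j, condWeight Q (supp E) S (t j) ≤
      if S ∈ avoiding E t then ∏ j, (q (t j) / (w - p)) else 0 := by
    intro S hS t
    split_ifs with h
    · exact Finset.prod_le_prod (fun j _ => condWeight_nonneg hQ _ _ _) fun j _ => hle S hS _
    · have : ∃ j, t j ∈ S := by
        by_contra! h'
        exact h (Finset.mem_filter.2 ⟨hS, h'⟩)
      obtain ⟨j, hj⟩ := this
      exact (Finset.prod_eq_zero (Finset.mem_univ j) (by simp [condWeight, hj])).le
  rw [Finset.sum_comm]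
  have hwp' : 0 ≤ w := by
    rw [hwdef]
    exact Finset.sum_nonneg fun y _ => hQ y
  -- Only members S avoiding t can have produced t, and a bad t is avoided by fewer than |E|/A of
  -- them.
  calc _ ≤ ∑ t : Fin r → α, (E.card / A) * ∏ j, (q (t j) / (w - p)) := by
        refine Finset.sum_le_sum fun t _ => ?_
        have hP : 0 ≤ ∏ j, (q (t j) / (w - p)) :=
          Finset.prod_nonneg fun j _ => div_nonneg (hq _) hwp.le
        by_cases hs : A * (avoiding E t).card < E.card
        · simp only [if_pos hs]
          calc _ ≤ ∑ S ∈ E, if S ∈ avoiding E t then ∏ j, (q (t j) / (w - p)) else 0 :=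
                Finset.sum_le_sum fun S hS => hprod S hS t
            _ = (avoiding E t).card * ∏ j, (q (t j) / (w - p)) := by
                rw [Finset.sum_ite_mem,
                  Finset.inter_eq_right.2 (show avoiding E t ⊆ E from Finset.filter_subset _ _)]
                simp
            _ ≤ _ := by
                refine mul_le_mul_of_nonneg_right ?_ hP
                rw [le_div_iff₀ hA]
                linarith
        · simp only [if_neg hs, Finset.sum_const_zero]
          positivity
    _ = (E.card / A) * (w / (w - p)) ^ r := by
        rw [← Finset.mul_sum, sum_pi_prod_eq_pow r fun y => q y / (w - p), ← Finset.sum_div, hqsum]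
    _ ≤ E.card / 2 := by
        rw [div_mul_eq_mul_div, div_le_div_iff₀ hA two_pos]
        have := mul_le_mul_of_nonneg_left hAr (Nat.cast_nonneg (α := ℝ) E.card)
        linarith

/-- If all large subfamilies of `E` have more than half of the support of `E`, then `E` has a star
whose number of tips is a constant fraction of the number `r + 1` of sampled points. -/
theorem exists_hasStar_of_forall_large [Fintype α] {E : Finset (Finset α)} (hne : E.Nonempty)
    {Q : α → ℝ} (hQ : ∀ y, 0 ≤ Q y) {p A : ℝ} {r : ℕ} (hp : 0 < p) (hA : 0 < A)
    (hE : ∀ S ∈ E, ∑ y ∈ S, Q y ≤ p) (hw : 4 * p ≤ ∑ y ∈ supp E, Q y)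
    (hAr : 2 * ((∑ y ∈ supp E, Q y) / (∑ y ∈ supp E, Q y - p)) ^ r ≤ A)
    (hbig : ∀ E' ⊆ E, (E.card : ℝ) ≤ A * E'.card →
      (∑ y ∈ supp E, Q y) / 2 < ∑ y ∈ supp E', Q y) :
    ∃ T, HasStar E T (supp E) ∧ ((r + 1 : ℕ) : ℝ) / 8 ≤ T.card := by
  classical
  set w := ∑ y ∈ supp E, Q y with hwdef
  have hEpos : (0 : ℝ) < E.card := by exact_mod_cast hne.card_pos
  let c : Finset α → α → ℝ := condWeight Q (supp E)
  have hc : ∀ S y, 0 ≤ c S y := fun S y => condWeight_nonneg hQ _ S y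
  have hD : ∀ S ∈ E, w - p ≤ ∑ z ∈ supp E \ S, Q z ∧ ∑ z ∈ supp E \ S, Q z ≤ w := by
    intro S hS
    have := Finset.sum_sdiff (f := Q) (subset_supp hS)
    have h0 : 0 ≤ ∑ y ∈ S, Q y := Finset.sum_nonneg fun y _ => hQ y
    constructor <;> linarith [hE S hS]
  have hDpos : ∀ S ∈ E, 0 < ∑ z ∈ supp E \ S, Q z := fun S hS => by linarith [(hD S hS).1]
  have hcsum : ∀ S ∈ E, ∑ y, c S y = 1 := fun S hS => sum_condWeight (hDpos S hS)
  have hsum : ∀ {m : ℕ}, ∑ S ∈ E, ∑ t : Fin m → α, ∏ j, c S (t j) = E.card := by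
    intro m
    rw [Finset.sum_congr rfl fun S hS => by rw [sum_pi_prod_eq_pow, hcsum S hS, one_pow]]
    simp
  -- Choose S uniformly from E, then r + 1 independent points of supp E \ S. Index i is good if x i
  -- can be a tip against all the other points.
  let good : (Fin (r + 1) → α) → Fin (r + 1) → Prop := fun x i =>
    ∃ R ∈ E, x i ∈ R ∧ ∀ j, j ≠ i → x j ∉ R
  have hgood : ∀ (i : Fin (r + 1)) (y : α) (t : Fin r → α),
      good (i.insertNth y t) i ↔ y ∈ supp (avoiding E t) := by
    intro i y t
    simp only [good, supp, avoiding, Finset.mem_biUnion, Finset.mem_filter, id,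
      Fin.insertNth_apply_same]
    constructor
    · rintro ⟨R, hR, hy, h⟩
      refine ⟨R, ⟨hR, fun j => ?_⟩, hy⟩
      have := h (i.succAbove j) (Fin.succAbove_ne i j)
      rwa [Fin.insertNth_apply_succAbove] at this
    · rintro ⟨R, ⟨hR, h⟩, hy⟩
      refine ⟨R, hR, hy, fun j hj => ?_⟩
      obtain ⟨j', rfl⟩ := Fin.exists_succAbove_eq hj
      rw [Fin.insertNth_apply_succAbove]
      exact h j'
  have hsplit : ∀ S, ∀ i : Fin (r + 1),
      ∑ x : Fin (r + 1) → α, (∏ j, c S (x j)) * (if good x i then (1 : ℝ) else 0) =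
      ∑ t : Fin r → α, (∏ j, c S (t j)) * ∑ y ∈ supp (avoiding E t), c S y := by
    intro S i
    rw [← (Fin.insertNthEquiv (fun _ => α) i).sum_comp, Fintype.sum_prod_type, Finset.sum_comm]
    refine Finset.sum_congr rfl fun t _ => ?_
    rw [Finset.mul_sum, ← Finset.univ_inter (supp (avoiding E t)), ← Finset.sum_ite_mem]
    refine Finset.sum_congr rfl fun y _ => ?_
    rw [Fin.prod_univ_succAbove _ i]
    have hg : good (Fin.insertNthEquiv (fun _ => α) i (y, t)) i ↔ y ∈ supp (avoiding E t) :=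
      hgood i y t
    simp only [hg]
    simp only [Fin.insertNthEquiv_apply, Fin.insertNth_apply_same, Fin.insertNth_apply_succAbove]
    split_ifs <;> ring
  -- The surviving members have support of mass above w/2, of which S takes at most p ≤ w/4;
  -- dividing by a total of at most w leaves 1/4.
  have hlower : ∀ S ∈ E, ∀ t : Fin r → α, ¬ A * (avoiding E t).card < E.card →
      1 / 4 ≤ ∑ y ∈ supp (avoiding E t), c S y := by
    intro S hS t ht
    have hsub : avoiding E t ⊆ E := Finset.filter_subset _ _
    have h1 := hbig _ hsub (not_lt.1 ht)
    have hsupp : supp (avoiding E t) ⊆ supp E := Finset.biUnion_subset_biUnion_of_subset_left _ hsub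
    have h2 : ∑ y ∈ supp (avoiding E t), c S y =
        (∑ y ∈ supp (avoiding E t) \ S, Q y) / ∑ z ∈ supp E \ S, Q z := by
      simp only [c, condWeight, Finset.sum_div]
      rw [Finset.sum_ite_mem]
      refine Finset.sum_congr ?_ fun _ _ => rfl
      ext y
      simp only [Finset.mem_inter, Finset.mem_sdiff]
      exact ⟨fun h => ⟨h.1, h.2.2⟩, fun h => ⟨h.1, hsupp h.1, h.2⟩⟩
    have h3 : ∑ y ∈ supp (avoiding E t), Q y ≤
        ∑ y ∈ supp (avoiding E t) \ S, Q y + ∑ y ∈ S, Q y := by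
      rw [← Finset.sum_inter_add_sum_sdiff (supp (avoiding E t)) S, add_comm]
      gcongr
      · exact fun y _ _ => hQ y
      · exact Finset.inter_subset_right
    rw [h2, le_div_iff₀ (hDpos S hS)]
    linarith [(hD S hS).2, hE S hS]
  -- The other r points are unfavourable with probability at most 1/2, so i is good with probability
  -- at least 1/2 · 1/4.
  have havg : ∀ i : Fin (r + 1), (E.card : ℝ) / 8 ≤ ∑ S ∈ E,
      ∑ x : Fin (r + 1) → α, (∏ j, c S (x j)) * (if good x i then (1 : ℝ) else 0) := by
    intro i
    have h1 := sum_sum_prod_condWeight_le hQ hA hE (by linarith) hAr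
    have h2 : ∑ S ∈ E, ∑ t : Fin r → α, ∏ j, c S (t j) = E.card := hsum
    have h3 : (1 / 4 : ℝ) * (∑ S ∈ E, ∑ t : Fin r → α, ∏ j, c S (t j) -
        ∑ S ∈ E, ∑ t : Fin r → α,
          (if A * (avoiding E t).card < E.card then ∏ j, c S (t j) else 0)) ≤
        ∑ S ∈ E, ∑ t : Fin r → α, (∏ j, c S (t j)) * ∑ y ∈ supp (avoiding E t), c S y := by
      simp only [← Finset.sum_sub_distrib, Finset.mul_sum _ _ (1 / 4 : ℝ)]
      refine Finset.sum_le_sum fun S hS => Finset.sum_le_sum fun t _ => ?_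
      have hP : 0 ≤ ∏ j, c S (t j) := Finset.prod_nonneg fun j _ => hc S _
      split_ifs with h
      · rw [sub_self, mul_zero]
        exact mul_nonneg hP (Finset.sum_nonneg fun y _ => hc S y)
      · rw [sub_zero, mul_comm]
        exact mul_le_mul_of_nonneg_left (hlower S hS t h) hP
    simp only [hsplit]
    refine le_trans ?_ h3
    rw [h2]
    linarith
  have hex : ∃ z ∈ E ×ˢ (Finset.univ : Finset (Fin (r + 1) → α)), ((r + 1 : ℕ) : ℝ) / 8 ≤
      ((Finset.univ.filter (good z.2)).card : ℝ) := by
    refine exists_le_of_le_weighted_sum _ (w := fun z => (∏ j, c z.1 (z.2 j)) / E.card)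
      (fun z _ => div_nonneg (Finset.prod_nonneg fun j _ => hc _ _) hEpos.le) ?_ ?_
    · rw [← Finset.sum_div, Finset.sum_product, div_eq_one_iff_eq hEpos.ne']
      exact hsum
    · have h1 : ∑ z ∈ E ×ˢ (Finset.univ : Finset (Fin (r + 1) → α)),
          (∏ j, c z.1 (z.2 j)) / E.card * ((Finset.univ.filter (good z.2)).card : ℝ) =
          (∑ i : Fin (r + 1), ∑ S ∈ E, ∑ x : Fin (r + 1) → α,
            (∏ j, c S (x j)) * (if good x i then (1 : ℝ) else 0)) / E.card := by
        rw [Finset.sum_comm, Finset.sum_product, Finset.sum_div]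
        refine Finset.sum_congr rfl fun S _ => ?_
        rw [Finset.sum_comm, Finset.sum_div]
        refine Finset.sum_congr rfl fun x _ => ?_
        rw [card_filter_eq_sum_ite, ← Finset.mul_sum]
        ring
      rw [h1, le_div_iff₀ hEpos]
      calc ((r + 1 : ℕ) : ℝ) / 8 * E.card = ∑ i : Fin (r + 1), (E.card : ℝ) / 8 := by
            rw [Finset.sum_const, Finset.card_univ, Fintype.card_fin, nsmul_eq_mul]
            ring
        _ ≤ _ := Finset.sum_le_sum fun i _ => havg i
  obtain ⟨⟨S, x⟩, -, hx⟩ := hex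
  obtain ⟨T, hT, hcard⟩ := exists_hasStar_of_indices (E := E) x (Finset.univ.filter (good x))
    (fun i hi => (Finset.mem_filter.1 hi).2)
  exact ⟨T, hT, by rw [hcard]; exact hx⟩

/-! ### Halving the support -/

/-- A family of light sets whose stars are small relative to their mass has a large subfamily
with at most half the support. -/
theorem exists_subset_half_supp [Fintype α] {E : Finset (Finset α)} (hne : E.Nonempty)
    {Q : α → ℝ} (hQ : ∀ y, 0 ≤ Q y) {p κ : ℝ} (hp : 0 < p) (hκ : 0 ≤ κ)
    (hE : ∀ S ∈ E, ∑ y ∈ S, Q y ≤ p) (hw : 4 * p ≤ ∑ y ∈ supp E, Q y)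
    (hstar : ∀ T, HasStar E T (supp E) → (T.card : ℝ) ≤ κ * ∑ y ∈ supp E, Q y) :
    ∃ E' ⊆ E, (E.card : ℝ) ≤ 2 * Real.exp (16 * κ * p) * E'.card ∧
      ∑ y ∈ supp E', Q y ≤ (∑ y ∈ supp E, Q y) / 2 := by
  by_contra! hbig
  set w := ∑ y ∈ supp E, Q y with hwdef
  have hw0 : 0 < w := by linarith
  have hwp : 0 < w - p := by linarith
  have hr : (⌊8 * κ * w⌋₊ : ℝ) ≤ 8 * κ * w := Nat.floor_le (by positivity)
  have hr' : 8 * κ * w < ⌊8 * κ * w⌋₊ + 1 := Nat.lt_floor_add_one _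
  -- This r makes (r + 1)/8 > κw, contradicting `hstar`; w ≤ 2(w - p) then gives (w/(w - p))^r ≤
  -- exp(16κp).
  obtain ⟨T, hT, hcard⟩ := exists_hasStar_of_forall_large (r := ⌊8 * κ * w⌋₊)
    (A := 2 * Real.exp (16 * κ * p)) hne hQ hp (by positivity) hE hw (by
      rw [← hwdef]
      have h1 : w / (w - p) ≤ Real.exp (p / (w - p)) := by
        have := Real.add_one_le_exp (p / (w - p))
        have h2 : w / (w - p) = p / (w - p) + 1 := by field_simp; ring
        linarith
      have h2 : (⌊8 * κ * w⌋₊ : ℝ) * (p / (w - p)) ≤ 16 * κ * p := by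
        have h3 : w * (p / (w - p)) ≤ 2 * p := by
          rw [← mul_div_assoc, div_le_iff₀ hwp]
          nlinarith
        calc (⌊8 * κ * w⌋₊ : ℝ) * (p / (w - p)) ≤ 8 * κ * w * (p / (w - p)) :=
              mul_le_mul_of_nonneg_right hr (by positivity)
          _ = 8 * κ * (w * (p / (w - p))) := by ring
          _ ≤ 8 * κ * (2 * p) := mul_le_mul_of_nonneg_left h3 (by positivity)
          _ = _ := by ring
      have h3 : (w / (w - p)) ^ ⌊8 * κ * w⌋₊ ≤ Real.exp (16 * κ * p) := by
        calc _ ≤ Real.exp (p / (w - p)) ^ ⌊8 * κ * w⌋₊ := pow_le_pow_left₀ (by positivity) h1 _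
          _ = Real.exp (⌊8 * κ * w⌋₊ * (p / (w - p))) := by rw [Real.exp_nat_mul]
          _ ≤ _ := Real.exp_le_exp.2 h2
      linarith) hbig
  have := hstar T hT
  push_cast at hcard
  linarith

/-- Size bound for a family of light sets, by repeatedly halving its support. -/
theorem card_le_of_supp_le [Fintype α] {Q : α → ℝ} (hQ : ∀ y, 0 ≤ Q y) {p κ l : ℝ} (hp : 0 < p)
    (hκ : 0 ≤ κ) (hl : 0 < l) (hl1 : l ≤ 1) (j : ℕ) {E : Finset (Finset α)}
    (hE : ∀ S ∈ E, ∑ y ∈ S, Q y ≤ p)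
    (hstar : ∀ T U, HasStar E T U → (T.card : ℝ) ≤ κ * ∑ y ∈ U, Q y)
    (hw : ∑ y ∈ supp E, Q y ≤ 2 ^ j * (4 * p)) :
    (E.card : ℝ) ≤ (2 * Real.exp (16 * κ * p)) ^ j *
      Real.exp (4 * κ * p * Real.log (1 / l) + l * Fintype.card α) := by
  induction j generalizing E with
  | zero =>
    rw [pow_zero, one_mul] at *
    refine card_le_exp_of_hasStar_le (by positivity) (fun T hT => (hstar T _ hT).trans ?_) hl hl1
    calc κ * ∑ y ∈ supp E, Q y ≤ κ * (4 * p) := mul_le_mul_of_nonneg_left hw hκ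
      _ = 4 * κ * p := by ring
  | succ j ih =>
    have h1 : (1 : ℝ) ≤ 2 * Real.exp (16 * κ * p) := by
      have := Real.one_le_exp (x := 16 * κ * p) (by positivity)
      linarith
    rw [pow_succ', mul_assoc]
    rcases E.eq_empty_or_nonempty with rfl | hne
    · rw [Finset.card_empty, Nat.cast_zero]
      positivity
    by_cases hsmall : ∑ y ∈ supp E, Q y ≤ 2 ^ j * (4 * p)
    · exact (ih hE hstar hsmall).trans (le_mul_of_one_le_left (by positivity) h1)
    · have hbig : 4 * p ≤ ∑ y ∈ supp E, Q y := by
        have : (1 : ℝ) ≤ 2 ^ j := one_le_pow₀ one_le_two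
        nlinarith [not_le.1 hsmall]
      obtain ⟨E', hE', hcard, hsupp⟩ := exists_subset_half_supp hne hQ hp hκ hE hbig
        (fun T hT => hstar T _ hT)
      have := ih (fun S hS => hE S (hE' hS)) (fun T U h => hstar T U (h.mono_left hE'))
        (by rw [pow_succ] at hw; linarith)
      exact hcard.trans (mul_le_mul_of_nonneg_left this (by positivity))

/-! ### Counting the light sets -/

/-- Each projection of a `k`-moonflower-free family is `p`-covered up to few exceptional sets. -/
theorem MoonflowerFree.exists_simplex_card_light_le [Fintype α] [Nonempty α] {k : ℕ} (hk : 0 < k)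
    (hkn : k ≤ Fintype.card α) {F : Finset (Finset α)} (hF : MoonflowerFree k F) {p : ℝ}
    (hp : 0 < p) (hp1 : p < 1) (J : Finset α) :
    ∃ Q ∈ stdSimplex ℝ α, ((((proj F J).filter fun S => ∑ y ∈ S, Q y < p).card : ℕ) : ℝ) ≤
      2 ^ (2 * (k * p) * (84 * Real.logb 2 (1 / p) +
        16 * Real.logb 2 (Fintype.card α / k) + 1)) := by
  obtain ⟨Q, hQ, hstar⟩ := exists_simplex_forall_hasStar hk
    (G := proj F J) (fun T U h => hF.card_lt_of_hasStar h)
  refine ⟨Q, hQ, ?_⟩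
  set E := (proj F J).filter fun S => ∑ y ∈ S, Q y < p with hEdef
  have hEF : E ⊆ proj F J := Finset.filter_subset _ _
  have hE : ∀ S ∈ E, ∑ y ∈ S, Q y < p := fun S hS => (Finset.mem_filter.1 hS).2
  have hk' : (0 : ℝ) < k := by exact_mod_cast hk
  have hkn' : (k : ℝ) ≤ Fintype.card α := by exact_mod_cast hkn
  set n : ℝ := (Fintype.card α : ℝ) with hn
  have hn0 : 0 < n := by linarith
  have hb : 0 ≤ Real.logb 2 (1 / p) :=
    Real.logb_nonneg one_lt_two (by rw [le_div_iff₀ hp]; linarith)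
  have ha : 0 ≤ Real.logb 2 (n / k) :=
    Real.logb_nonneg one_lt_two (by rw [le_div_iff₀ hk']; linarith)
  rcases lt_or_ge (k * p) (1 / 4) with hkp | hkp
  -- A nonempty S is itself a star with one tip, so Q(S) ≥ 1/(4k) > p and S is not light.
  · have hE0 : E ⊆ {∅} := by
      intro S hS
      rw [Finset.mem_singleton]
      by_contra hne
      obtain ⟨x, hx⟩ := Finset.nonempty_iff_ne_empty.2 hne
      have h1 := hstar {x} S (fun y hy => ⟨S, hEF hS, subset_rfl, by
        rw [Finset.mem_singleton.1 hy]
        simp [hx]⟩)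
      have h2 := hE S hS
      rw [Finset.card_singleton, Nat.cast_one] at h1
      nlinarith
    have h1 : (E.card : ℝ) ≤ 1 := by exact_mod_cast Finset.card_le_card hE0
    exact h1.trans (Real.one_le_rpow one_le_two (by positivity))
  · have hlog : ∀ x : ℝ, 0 ≤ Real.logb 2 x → Real.log x ≤ Real.logb 2 x := by
      intro x hx
      have h2 : Real.log 2 ≤ 1 := by linarith [Real.log_two_lt_d9]
      have h3 : Real.logb 2 x * Real.log 2 = Real.log x :=
        div_mul_cancel₀ _ (Real.log_pos one_lt_two).ne'
      rw [← h3]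
      exact mul_le_of_le_one_right hx h2
    set b := Real.logb 2 (1 / p) with hbdef
    have hj : (⌊b⌋₊ : ℝ) ≤ b := Nat.floor_le hb
    have hj' : (1 : ℝ) ≤ 2 ^ ⌊b⌋₊ * (4 * p) := by
      have h1 : (1 / p : ℝ) = 2 ^ b := by
        rw [hbdef, Real.rpow_logb two_pos (by norm_num) (by positivity)]
      have h2 : (2 : ℝ) ^ b ≤ 2 ^ ((⌊b⌋₊ : ℝ) + 1) :=
        Real.rpow_le_rpow_of_exponent_le one_le_two (Nat.lt_floor_add_one b).le
      rw [← h1, Real.rpow_add two_pos, Real.rpow_natCast, Real.rpow_one, div_le_iff₀ hp] at h2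
      have : (0 : ℝ) < 2 ^ ⌊b⌋₊ * p := by positivity
      linarith
    -- Here l = kp/n makes the Sauer–Shelah term l·n equal to kp.
    have hmain := card_le_of_supp_le hQ.1 hp (κ := 4 * k) (by positivity)
      (l := k * p / n) (by positivity)
      (by rw [div_le_one hn0]; nlinarith) ⌊b⌋₊ (fun S hS => (hE S hS).le)
      (fun T U h => hstar T U (h.mono_left hEF)) (by
        refine le_trans ?_ hj'
        rw [← hQ.2]
        exact Finset.sum_le_sum_of_subset_of_nonneg (Finset.subset_univ _) fun y _ _ => hQ.1 y)
    -- Since 4kp ≥ 1, the factor 2 lost per halving is absorbed: 68 = 64 + 4.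
    have h2 : 2 * Real.exp (16 * (4 * k) * p) ≤ Real.exp (68 * (k * p)) := by
      have h3 : (2 : ℝ) ≤ Real.exp (4 * (k * p)) := by
        linarith [Real.add_one_le_exp (4 * (k * p))]
      calc _ ≤ Real.exp (4 * (k * p)) * Real.exp (16 * (4 * k) * p) :=
            mul_le_mul_of_nonneg_right h3 (Real.exp_nonneg _)
        _ = _ := by rw [← Real.exp_add]; ring_nf
    have h3 : (2 * Real.exp (16 * (4 * k) * p)) ^ ⌊b⌋₊ ≤ Real.exp (68 * (k * p) * b) := by
      calc _ ≤ Real.exp (68 * (k * p)) ^ ⌊b⌋₊ := pow_le_pow_left₀ (by positivity) h2 _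
        _ = Real.exp (⌊b⌋₊ * (68 * (k * p))) := by rw [Real.exp_nat_mul]
        _ ≤ _ := Real.exp_le_exp.2 (by rw [mul_comm]; gcongr)
    have h4 : Real.log (1 / (k * p / n)) ≤ b + Real.logb 2 (n / k) := by
      have : 1 / (k * p / n) = 1 / p * (n / k) := by field_simp
      rw [this, Real.log_mul (by positivity) (by positivity)]
      exact add_le_add (hlog _ hb) (hlog _ ha)
    have h5 : k * p / n * n = k * p := div_mul_cancel₀ _ hn0.ne'
    have h6 : (E.card : ℝ) ≤
        Real.exp (k * p * (84 * b + 16 * Real.logb 2 (n / k) + 1)) := by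
      refine hmain.trans ((mul_le_mul_of_nonneg_right h3 (Real.exp_nonneg _)).trans ?_)
      rw [← Real.exp_add, Real.exp_le_exp, ← hn, h5]
      have := mul_le_mul_of_nonneg_left h4 (by positivity : 0 ≤ 4 * (4 * k) * p)
      linarith
    refine h6.trans ?_
    rw [Real.rpow_def_of_pos two_pos, Real.exp_le_exp]
    -- Passing from base e to base 2 costs a factor of at most 2 in the exponent.
    have h7 : (1 / 2 : ℝ) ≤ Real.log 2 := by linarith [Real.log_two_gt_d9]
    have h8 : 0 ≤ k * p * (84 * b + 16 * Real.logb 2 (n / k) + 1) := by positivity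
    nlinarith

end Moonflower

/-! ### The lemma -/

theorem lemma1p10 :
    ∃ B : ℝ, 1 ≤ B ∧
      ∀ (n k w : ℕ) (p : ℝ) (F : Finset (Finset (Fin n))),
        1 ≤ k → k ≤ n → 0 < p → p < 1 →
        (∀ S ∈ F, S.card ≤ w) →
        Moonflower.MoonflowerFree k F →
        (Moonflower.supp F).card = n →
        (2 * k ≤ n → p ≤ 1 / 2 →
          Moonflower.AlmostCovered p
            ((2 : ℝ) ^ (B * k * Real.logb 2 ((n : ℝ) / k) * (p * Real.logb 2 (1 / p)))) F) ∧
        Moonflower.AlmostCovered p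
          ((2 : ℝ) ^ (B * k * Real.logb 2 (Real.exp 1 * n / k) * (p * Real.logb 2 (2 / p)))) F := by
  -- 202 = 2 · (84 + 16 + 1): once a, b ≥ 1, each of b, a and 1 is at most ab. The hypotheses of
  -- part 1, or the extra factors e and 2 in part 2, ensure a, b ≥ 1.
  refine ⟨202, by norm_num, fun n k w p F hk hkn hp hp1 _ hF _ => ?_⟩
  have : Nonempty (Fin n) := ⟨⟨0, by omega⟩⟩
  have hk' : (0 : ℝ) < k := by exact_mod_cast hk
  have hn' : (0 : ℝ) < n := by exact_mod_cast hk.trans hkn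
  have hlog : ∀ x : ℝ, 2 ≤ x → 1 ≤ Real.logb 2 x := fun x hx => by
    rw [Real.le_logb_iff_rpow_le one_lt_two (by linarith), Real.rpow_one]
    exact hx
  have key : ∀ a b : ℝ, 1 ≤ a → 1 ≤ b → Real.logb 2 ((n : ℝ) / k) ≤ a → Real.logb 2 (1 / p) ≤ b →
      Moonflower.AlmostCovered p ((2 : ℝ) ^ (202 * k * a * (p * b))) F := by
    intro a b ha hb hna hpb J
    obtain ⟨Q, hQ, hcard⟩ :=
      hF.exists_simplex_card_light_le hk (by simpa using hkn) hp hp1 J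
    refine ⟨_, Finset.filter_subset _ _, hcard.trans
      (Real.rpow_le_rpow_of_exponent_le one_le_two ?_), Q, hQ, ?_⟩
    · rw [Fintype.card_fin]
      have h1 : 84 * Real.logb 2 (1 / p) + 16 * Real.logb 2 ((n : ℝ) / k) + 1 ≤ 101 * (a * b) := by
        nlinarith
      calc _ ≤ 2 * (k * p) * (101 * (a * b)) := mul_le_mul_of_nonneg_left h1 (by positivity)
        _ = _ := by ring
    · intro S hS
      simp only [Finset.mem_sdiff, Finset.mem_filter, not_and, not_lt] at hS
      exact hS.2 hS.1
  refine ⟨fun hn hp2 => key _ _ (hlog _ ?_) (hlog _ ?_) le_rfl le_rfl,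
    key _ _ (hlog _ ?_) (hlog _ ?_) ?_ ?_⟩
  · rw [le_div_iff₀ hk']
    exact_mod_cast hn
  · rw [le_div_iff₀ hp]
    linarith
  · rw [le_div_iff₀ hk']
    have : (k : ℝ) ≤ n := by exact_mod_cast hkn
    exact mul_le_mul (by linarith [Real.add_one_le_exp (1 : ℝ)]) this hk'.le (Real.exp_nonneg _)
  · rw [le_div_iff₀ hp]
    linarith
  · refine Real.logb_le_logb_of_le one_lt_two (by positivity) ?_
    gcongr
    exact le_mul_of_one_le_left hn'.le (Real.one_le_exp zero_le_one)
  · refine Real.logb_le_logb_of_le one_lt_two (by positivity) ?_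
    gcongr
    norm_num
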